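/- Let $S=\Gamma\backslash\mathbb H$ be a hyperbolic surface of finite area (possibly with cusps; $\Gamma$ a discrete group of orientation-preserving isometries of the hyperbolic plane $\mathbb H$ acting freely). Let $\gamma_1,\dots,\gamma_m$ be a pants decomposition of $S$ by geodesics, i.e. pairwise disjoint simple closed geodesics such that every component of $S\setminus\bigcup_i\gamma_i$ is homeomorphic to a thrice punctured sphere. Suppose that $l(\gamma_i)\le B$ for all $i$, and that the systole length of $S$ (the least length of a nontrivial closed geodesic) is at least $I$, where $I>0$. Then for each $j$, every transversal $\delta_j$ to $\gamma_j$ satisfies $$l(\delta_j)\le 3B-4\log I+12\log 2 .$$ Here transversals are defined as follows. Each pair of pants $Y$ of the decomposition is the pasting of two isometric right-angled hexagons (one the mirror image of the other, with an ideal vertex in place of a side for each cusp of $Y$) along three seams, which are geodesics perpendicular to the boundary of $Y$; each two of the three ends of $Y$ (boundary geodesics or cusps) are joined by one seam. Let $Y,Y'$ be the pairs of pants on the two sides of $\gamma_j$ (possibly $Y=Y'$, seen from its two ends glued along $\gamma_j$). Let $\xi$ be one of the two other ends of $Y$ and $\eta$ one of the two other ends of $Y'$, and let $p$, $p'$ be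 the seams from $\gamma_j$ to $\xi$ in $Y$ and from $\gamma_j$ to $\eta$ in $Y'$. If $\xi$ or $\eta$ is a cusp, replace it by a horocycle about the cusp in the pair of pants, and cut off the seam there. Let $c$ be an arc along $\gamma_j$ from the initial point of $p$ to the initial point of $p'$ of length $|\alpha|\,l(\gamma_j)$, where $\alpha\in[-\tfrac12,\tfrac12]$ is the twist parameter. The transversal $\delta_j$ is the closed geodesic in the free homotopy class of the concatenated closed path $$\xi\,p^{-1}\,c\,p'\,\eta\,p'^{-1}\,c^{-1}\,p ,$$ where $\xi$ and $\eta$ are each run through once, both with the pair of pants on the left or both with the pair of pants on the right. -/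

import Mathlib

open scoped MatrixGroups UpperHalfPlane

namespace HypSurf

/-! ### Hyperbolic surfaces

A hyperbolic surface of genus `g` with `n` cusps is the quotient `Γ \ ℍ` of the hyperbolic plane by
a discrete group of orientation-preserving isometries acting freely, with finite area. Elements of
`SL(2, ℝ)` are only used through their action on `ℍ`, so that `Γ` may or may not contain `-1`. -/

/-- `Γ` is discrete, an element of `Γ` with a fixed point in `ℍ` acts as the identity, and `Γ \ ℍ`
has finite area: some measurable set of finite hyperbolic area meets every `Γ`-orbit. -/
structure IsSurfaceGroup (Γ : Subgroup SL(2, ℝ)) : Prop where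
  discrete : DiscreteTopology Γ
  free : ∀ g ∈ Γ, ∀ z : ℍ, g • z = z → ∀ w : ℍ, g • w = w
  finite_area : ∃ D : Set ℍ, MeasurableSet D ∧ MeasureTheory.volume D < ⊤ ∧
    ∀ z : ℍ, ∃ g ∈ Γ, g • z ∈ D

/-- The surface `Γ \ ℍ`, with the quotient topology. -/
abbrev Surface (Γ : Subgroup SL(2, ℝ)) : Type := MulAction.orbitRel.Quotient Γ ℍ

/-- The universal covering `ℍ → Γ \ ℍ`. -/
noncomputable def proj (Γ : Subgroup SL(2, ℝ)) (z : ℍ) : Surface Γ := Quotient.mk _ z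

/-! ### Closed curves and closed geodesics -/

/-- Free homotopy of closed curves; a closed curve is given as a map on `ℝ` of period `1`. -/
def FreelyHomotopic {X : Type*} [TopologicalSpace X] (c d : ℝ → X) : Prop :=
  ∃ H : ℝ → ℝ → X, Continuous (fun p : ℝ × ℝ => H p.1 p.2) ∧ (∀ s t, H s (t + 1) = H s t) ∧
    (∀ t, H 0 t = c t) ∧ (∀ t, H 1 t = d t)

/-- A (nontrivial, oriented) closed geodesic of `Γ \ ℍ`: a unit speed geodesic line `lift` of `ℍ`
which is translated along itself by the deck transformation `hol` by the amount `length > 0`.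
The closed geodesic runs once through the image of `lift` on `[0, length]`. -/
structure ClosedGeodesic (Γ : Subgroup SL(2, ℝ)) where
  lift : ℝ → ℍ
  isometry_lift : Isometry lift
  length : ℝ
  length_pos : 0 < length
  hol : SL(2, ℝ)
  hol_mem : hol ∈ Γ
  lift_add : ∀ t, lift (t + length) = hol • lift t

namespace ClosedGeodesic

variable {Γ : Subgroup SL(2, ℝ)}

/-- The closed geodesic parametrized with constant speed and period `1`. -/
noncomputable def curve (c : ClosedGeodesic Γ) (t : ℝ) : Surface Γ := proj Γ (c.lift (t * c.length))

/-- The set of points of the surface on the closed geodesic. -/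
def image (c : ClosedGeodesic Γ) : Set (Surface Γ) := Set.range c.curve

/-- The closed geodesic has no self-intersection and is not traversed several times. -/
def IsSimple (c : ClosedGeodesic Γ) : Prop := Set.InjOn c.curve (Set.Ico 0 1)

end ClosedGeodesic

/-- The systole length: the least length of a nontrivial closed geodesic. -/
noncomputable def systole (Γ : Subgroup SL(2, ℝ)) : ℝ :=
  sInf (Set.range (fun c : ClosedGeodesic Γ => c.length))

/-! ### Pants decompositions -/

/-- The thrice punctured sphere, as the plane without two points. -/
abbrev ThricePuncturedSphere : Type := {z : ℂ // z ≠ 0 ∧ z ≠ 1}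

/-- A pants decomposition of `Γ \ ℍ` by geodesics: pairwise disjoint simple closed geodesics such
that every connected component of the complement is a thrice punctured sphere. -/
structure PantsDecomposition (Γ : Subgroup SL(2, ℝ)) (m : ℕ) where
  γ : Fin m → ClosedGeodesic Γ
  simple : ∀ i, (γ i).IsSimple
  disjoint : ∀ i j, i ≠ j → Disjoint (γ i).image (γ j).image
  pants : ∀ x ∈ (⋃ i, (γ i).image)ᶜ,
    Nonempty (connectedComponentIn (⋃ i, (γ i).image)ᶜ x ≃ₜ ThricePuncturedSphere)

variable {Γ : Subgroup SL(2, ℝ)} {m : ℕ}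

namespace PantsDecomposition

/-- The preimage in `ℍ` of the complement of the pants curves. -/
def upper (P : PantsDecomposition Γ m) : Set ℍ :=
  proj Γ ⁻¹' (⋃ i, (P.γ i).image)ᶜ

/-- `R` is a component of the preimage in `ℍ` of the complement of the pants curves. It is the
universal cover of (the interior of) a pair of pants `Y = proj Γ '' R` of the decomposition, and its
boundary lines are lifts of the boundary geodesics of `Y`. -/
def IsRegion (P : PantsDecomposition Γ m) (R : Set ℍ) : Prop :=
  ∃ z ∈ P.upper, R = connectedComponentIn P.upper z

/-- `x` is the deck transformation of a pants curve, run once in one of its two directions: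
it acts as a `Γ`-conjugate of the deck transformation of that curve or of its inverse. -/
def IsPantsCurveLoop (P : PantsDecomposition Γ m) (x : SL(2, ℝ)) : Prop :=
  ∃ i, ∃ h ∈ Γ, (∀ z : ℍ, x • z = (h * (P.γ i).hol * h⁻¹) • z) ∨
    (∀ z : ℍ, x • z = (h * (P.γ i).hol⁻¹ * h⁻¹) • z)

end PantsDecomposition

/-- `x` is the deck transformation of a loop running once around a cusp: a parabolic element of `Γ`
which (up to elements that act trivially) is not a proper power in `Γ`. -/
def IsCuspLoop (Γ : Subgroup SL(2, ℝ)) (x : SL(2, ℝ)) : Prop :=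
  x ∈ Γ ∧ (x : Matrix (Fin 2) (Fin 2) ℝ).IsParabolic ∧
    ∀ y ∈ Γ, ∀ n : ℤ, (∀ z : ℍ, y ^ n • z = x • z) → n = 1 ∨ n = -1

/-- `ρ` is the reflection of `ℍ` in the geodesic line with unit speed parametrization `s`. -/
def IsReflection (s : ℝ → ℍ) (ρ : ℍ → ℍ) : Prop :=
  Isometry s ∧ Isometry ρ ∧ ∀ z, ρ z = z ↔ z ∈ Set.range s

/-- The decomposition of a pair of pants `Y` into two isometric right-angled hexagons, one the
mirror image of the other, lifted to the universal cover `R` of `Y`; the cusps of `Y` are allowed as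
ideal sides of the hexagons.

The three ends of `Y` (boundary geodesics or cusps) are numbered `0`, `1`, `2`. The hexagon is the
part of the closure of `R` enclosed by three geodesic lines `seam 0`, `seam 1`, `seam 2`, where
`seam i` joins the two ends other than `i`; the sides of the hexagon on these lines are the seams.
The hexagon `A` and its mirror image `ρ A` in one of the seams tile `R` under `Γ`, and they
are pasted along all three seams in the mirror symmetric way. So the boundary loop `loop i` at the
end `i` is the product of the reflections in the two seams that meet this end: it translates by
twice the side of the hexagon at that end, and its axis is the common perpendicular of these two
seams (respectively its fixed point is their common ideal endpoint). With these choices the three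
loops satisfy `loop 0 * loop 1 * loop 2 = 1` as isometries of `ℍ`, and `R` lies on the same side of
all three of them. -/
structure HexagonDecomposition (P : PantsDecomposition Γ m) (R : Set ℍ) where
  seam : Fin 3 → ℝ → ℍ
  refl : Fin 3 → ℍ → ℍ
  isReflection : ∀ i, IsReflection (seam i) (refl i)
  /-- An interior point of the hexagon. -/
  center : ℍ
  center_mem : center ∈ R
  /-- Any two seams lie on the side of the third one that contains `center`. -/
  seam_side : ∀ i j, i ≠ j → ∀ t, dist (seam j t) center < dist (seam j t) (refl i center)
  loop : Fin 3 → SL(2, ℝ)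
  loop_mem : ∀ i, loop i ∈ Γ
  loop_image : ∀ i, (fun z : ℍ => loop i • z) '' R = R
  loop_end : ∀ i, P.IsPantsCurveLoop (loop i) ∨ IsCuspLoop Γ (loop i)
  loop_smul : ∀ i, ∀ z : ℍ, loop i • z = refl (i + 1) (refl (i + 2) z)
  /-- Every point of `R` has a translate in the hexagon or in its mirror image. -/
  cover : ∀ z ∈ R, ∃ g ∈ Γ, ∃ w ∈ closure R,
    (∀ i, dist w center ≤ dist w (refl i center)) ∧ (g • z = w ∨ g • z = refl 2 w)
  /-- No two different points in the interiors of the hexagon and of its mirror image are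
  translates of each other. -/
  embed : ∀ g ∈ Γ, ∀ z ∈ R, ∀ w ∈ R,
    (∀ i, dist z center < dist z (refl i center)) →
    (∀ i, dist w center < dist w (refl i center)) →
    (g • z = w → z = w) ∧ g • z ≠ refl 2 w

/-! ### Transversals -/

/-- The geodesic segment between two points. -/
def segment (z w : ℍ) : Set ℍ := {u | dist z u + dist u w = dist z w}

/-- The points moved by `x` as far as `o`. This is the axis of `x` if `x` is hyperbolic and `o` lies
on its axis, and it is the horocycle through `o` if `x` is parabolic. -/
def boundaryCurve (x : SL(2, ℝ)) (o : ℍ) : Set ℍ := {z | dist z (x • z) = dist o (x • o)}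

/-- `σ`, followed from time `0` to time `1`, is the lift to `ℍ` of the concatenated closed path
`ξ p⁻¹ c p' η p'⁻¹ c⁻¹ p`. Here `p` is the segment from `f` to `o`, `c` the segment from `f` to
`f'`, `p'` the segment from `f'` to `o'`; `ξ` runs from `x⁻¹ • o` to `o` on the boundary
curve of `x`, and `η` runs from `o'` to `y • o'` on the boundary curve of `y`. -/
structure IsConcatenation (x y : SL(2, ℝ)) (f f' o o' : ℍ) (σ : ℝ → ℍ) : Prop where
  continuous : Continuous σ
  periodic : ∀ t, σ (t + 1) = (y * x) • σ t
  at_0 : σ 0 = x⁻¹ • o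
  along_ξ : Set.MapsTo σ (Set.Icc 0 (1 / 8)) (boundaryCurve x o)
  at_1 : σ (1 / 8) = o
  along_p_inv : Set.MapsTo σ (Set.Icc (1 / 8) (2 / 8)) (segment o f)
  at_2 : σ (2 / 8) = f
  along_c : Set.MapsTo σ (Set.Icc (2 / 8) (3 / 8)) (segment f f')
  at_3 : σ (3 / 8) = f'
  along_p' : Set.MapsTo σ (Set.Icc (3 / 8) (4 / 8)) (segment f' o')
  at_4 : σ (4 / 8) = o'
  along_η : Set.MapsTo σ (Set.Icc (4 / 8) (5 / 8)) (boundaryCurve y o')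
  at_5 : σ (5 / 8) = y • o'
  along_p'_inv : Set.MapsTo σ (Set.Icc (5 / 8) (6 / 8)) (segment (y • o') (y • f'))
  at_6 : σ (6 / 8) = y • f'
  along_c_inv : Set.MapsTo σ (Set.Icc (6 / 8) (7 / 8)) (segment (y • f') (y • f))
  at_7 : σ (7 / 8) = y • f
  along_p : Set.MapsTo σ (Set.Icc (7 / 8) 1) (segment (y • f) (y • o))

/-- `δ` is a transversal to the pants curve `γ k`.

`R` and `R'` are the two regions on the two sides of the line `(P.γ k).lift`; they cover the pairs
of pants `Y` and `Y'` that are glued along `γ k` (possibly `Y = Y'`). In both of them `γ k` is the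
end `0`; the end `1` is `ξ` for `Y` and `η` for `Y'`. The seam `p` from `γ k` to `ξ` starts at
`(P.γ k).lift s`, and the seam `p'` from `γ k` to `η` at `(P.γ k).lift (s + α * (P.γ k).length)`,
where `α ∈ [-1/2, 1/2]` is the twist parameter. The seams end on `ξ` and `η`, respectively on
horocycles about the cusps in place of `ξ` and `η`: the condition that the boundary curve
through `o` stays in the closure of `R` says that `o` is on the boundary geodesic, or that the
horocycle through `o` does not leave the pair of pants. The loops at the ends `0` of `Y` and `Y'`
are inverse to each other, so that `ξ` and `η` are both run through with the pairs of
pants on the same side (left or right), and `δ` is the closed geodesic in the free homotopy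
class of the concatenated path. -/
def IsTransversal (P : PantsDecomposition Γ m) (k : Fin m) (δ : ClosedGeodesic Γ) : Prop :=
  ∃ (R R' : Set ℍ) (F : HexagonDecomposition P R) (F' : HexagonDecomposition P R')
    (s α : ℝ) (f f' o o' : ℍ) (σ : ℝ → ℍ),
    P.IsRegion R ∧ P.IsRegion R' ∧ R ≠ R' ∧
    (∀ z : ℍ, F.loop 0 • z = (P.γ k).hol • z) ∧
    (∀ z : ℍ, F'.loop 0 • z = (P.γ k).hol⁻¹ • z) ∧
    α ∈ Set.Icc (-1 / 2 : ℝ) (1 / 2) ∧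
    f = (P.γ k).lift s ∧ f ∈ Set.range (F.seam 2) ∧
    f' = (P.γ k).lift (s + α * (P.γ k).length) ∧ f' ∈ Set.range (F'.seam 2) ∧
    o ∈ Set.range (F.seam 2) ∧ boundaryCurve (F.loop 1) o ⊆ closure R ∧
    o' ∈ Set.range (F'.seam 2) ∧ boundaryCurve (F'.loop 1) o' ⊆ closure R' ∧
    IsConcatenation (F.loop 1) (F'.loop 1) f f' o o' σ ∧
    FreelyHomotopic δ.curve (fun t => proj Γ (σ t))

end HypSurf

/-!
The idea is to compute the length of the transversal from a trace: `2 cosh (l(δ) / 2)` is the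
absolute value of the trace of a deck transformation of `δ`. Since `ℍ → Γ \ ℍ` is a covering map,
the free homotopy lifts, and that deck transformation is conjugate (up to sign) to `y * x`, where
`x` and `y` are the boundary loops at the ends `ξ` and `η`
(`isCoveringMap_proj`, `exists_conj_of_freelyHomotopic`).

Choose coordinates in which the lift of the pants curve `γ`, of length `l`, is the imaginary axis
and the seam `p` starts at `i`. This seam is perpendicular to the axis, and `x` is the reflection in
the seam joining `ξ` to the third end, followed by the reflection in `p`. Therefore the off-diagonal
entries of `x` are opposite to each other; those of `y` are so up to the factor
`e ^ (2 τ)`, where `τ` is the signed length of the arc `c` (`boundary_loop_entries`). What remains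
free in the matrix of `x` is determined, up to signs, by the traces of `x` and of `hol * x`, which
are boundary loops of a pair of pants (up to sign and inversion) and so have traces at
most `2 M` in absolute value, with `M = cosh (B / 2)`; a cusp only means trace `± 2`. The same holds for `y` and `hol⁻¹ * y`.
With `C = cosh (l / 2)` and `|τ| ≤ l / 2` a computation with these matrices
(`abs_trace_mul_le_of_offDiag`) gives

  `cosh (l(δ) / 2) ≤ C + 2 M ^ 2 (C + 1) / (C - 1)`.

It is essential here that the loops at `γ` of the two pairs of pants are inverse to each other;
the signs of the individual traces do not matter. As `(C + 1) / (C - 1) = coth² (l / 4)` and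
`coth t ≤ 1 + 1 / t`, and `I ≤ l ≤ B`, the right-hand side is at most `2 ^ 5 e ^ (3 B / 2) / I ^ 2`,
which is the claimed bound (`le_of_two_cosh_mul_le`).

Geodesics and reflections are handled through two explicit facts: every unit speed geodesic is a
translate of `t ↦ i e ^ t` under `SL(2, ℝ)` (`exists_eq_smul_axisPoint`), and a reflection is the
action of a matrix of negative determinant (`IsReflection.exists_gl`), which has trace `0` as soon
as it has a fixed point.
-/

namespace HypSurf

open Matrix UpperHalfPlane

/-! ### Geodesic lines -/

/-- The point `i e ^ t` of the imaginary axis. -/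
noncomputable def axisPoint (t : ℝ) : ℍ := ⟨⟨0, Real.exp t⟩, Real.exp_pos t⟩

@[simp] lemma axisPoint_re (t : ℝ) : (axisPoint t).re = 0 := rfl
@[simp] lemma axisPoint_im (t : ℝ) : (axisPoint t).im = Real.exp t := rfl

lemma isometry_axisPoint : Isometry axisPoint := isometry_vertical_line 0

lemma cosh_dist_re_im (z w : ℍ) : Real.cosh (dist z w) * (2 * z.im * w.im) =
    (z.re - w.re) ^ 2 + z.im ^ 2 + w.im ^ 2 := by
  have h1 := z.im_pos
  have h2 := w.im_pos
  rw [cosh_dist', div_mul_cancel₀ _ (by positivity)]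

/-- Two points with the same distances to two points of the imaginary axis have the same height,
and real parts that agree up to sign. -/
lemma im_eq_and_re_sq_eq {z w : ℍ} (h0 : dist z (axisPoint 0) = dist w (axisPoint 0))
    (h1 : dist z (axisPoint 1) = dist w (axisPoint 1)) :
    z.im = w.im ∧ z.re ^ 2 = w.re ^ 2 := by
  have a0 := cosh_dist_re_im z (axisPoint 0)
  have a1 := cosh_dist_re_im z (axisPoint 1)
  have b0 := cosh_dist_re_im w (axisPoint 0)
  have b1 := cosh_dist_re_im w (axisPoint 1)
  rw [h0] at a0
  rw [h1] at a1
  simp only [axisPoint_re, axisPoint_im, sub_zero, Real.exp_zero] at a0 a1 b0 b1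
  set c0 := Real.cosh (dist w (axisPoint 0))
  set c1 := Real.cosh (dist w (axisPoint 1))
  have he : 1 < Real.exp 1 := by simp
  set e := Real.exp 1
  have hz := z.im_pos
  have hw := w.im_pos
  have key : (z.im - w.im) * (1 - e ^ 2) = 0 := by
    linear_combination w.im * a0 - w.im * a1 - z.im * b0 + z.im * b1
  have him : z.im = w.im := by
    rcases mul_eq_zero.1 key with h | h
    · linarith
    · nlinarith
  refine ⟨him, ?_⟩
  rw [him] at a0
  linarith

/-- An isometry of the line into `ℍ` is determined by two of its values. -/
lemma eq_axisPoint_of_isometry {s : ℝ → ℍ} (hs : Isometry s) (h0 : s 0 = axisPoint 0)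
    (h1 : s 1 = axisPoint 1) (t : ℝ) : s t = axisPoint t := by
  obtain ⟨him, hre⟩ := im_eq_and_re_sq_eq (z := s t) (w := axisPoint t)
    (by rw [← h0, hs.dist_eq, h0, isometry_axisPoint.dist_eq])
    (by rw [← h1, hs.dist_eq, h1, isometry_axisPoint.dist_eq])
  refine UpperHalfPlane.ext (Complex.ext ?_ him)
  simpa using hre

lemma specialLinear_smul_eq_iff (g : SL(2, ℝ)) (z w : ℍ) : g • z = w ↔
    (g 0 0 * (z : ℂ) + g 0 1) = w * (g 1 0 * (z : ℂ) + g 1 1) := by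
  rw [UpperHalfPlane.ext_iff, coe_specialLinearGroup_apply, div_eq_iff]
  · simp
  · exact denom_ne_zero (g : GL (Fin 2) ℝ) z

lemma det_fin_two_eq_one (g : SL(2, ℝ)) : g 0 0 * g 1 1 - g 0 1 * g 1 0 = 1 := by
  rw [← Matrix.det_fin_two]; exact g.2

/-- A rotation about `i` moves any given point to the imaginary axis. -/
lemma exists_smul_axisPoint_zero_and_re_eq_zero (z : ℍ) :
    ∃ g : SL(2, ℝ), g • axisPoint 0 = axisPoint 0 ∧ (g • z).re = 0 := by
  let rot : ℝ → SL(2, ℝ) := fun θ => ⟨!![Real.cos θ, Real.sin θ; -Real.sin θ, Real.cos θ], by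
    rw [Matrix.det_fin_two_of]; nlinarith [Real.sin_sq_add_cos_sq θ]⟩
  have hfix : ∀ θ, rot θ • axisPoint 0 = axisPoint 0 := by
    intro θ
    rw [specialLinear_smul_eq_iff]
    apply Complex.ext <;> simp [rot, axisPoint]
  have hre : ∀ θ, (Real.cos θ * z.re + Real.sin θ) * (-Real.sin θ * z.re + Real.cos θ)
        - Real.cos θ * Real.sin θ * z.im ^ 2 = 0 → (rot θ • z).re = 0 := by
    intro θ hθ
    have h := (specialLinear_smul_eq_iff (rot θ) z _).1 rfl
    generalize rot θ • z = w at h ⊢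
    have hr := congrArg Complex.re h
    have hi := congrArg Complex.im h
    simp only [rot, Matrix.cons_val', Matrix.cons_val_zero, Matrix.cons_val_one,
      Matrix.of_apply, Matrix.cons_val_fin_one, Complex.add_re, Complex.add_im, Complex.mul_re,
      Complex.mul_im, Complex.ofReal_re, Complex.ofReal_im, coe_re, coe_im] at hr hi
    have key : w.re * ((-Real.sin θ * z.re + Real.cos θ) ^ 2 + (Real.sin θ * z.im) ^ 2) = 0 := by
      linear_combination hθ - (-Real.sin θ * z.re + Real.cos θ) * hr + Real.sin θ * z.im * hi
    refine (mul_eq_zero.1 key).resolve_right fun h0 => ?_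
    have h1 : Real.sin θ * z.im = 0 := by nlinarith [sq_nonneg (-Real.sin θ * z.re + Real.cos θ)]
    have h2 : Real.sin θ = 0 := (mul_eq_zero.1 h1).resolve_right z.im_ne_zero
    have h3 := Real.sin_sq_add_cos_sq θ
    rw [h2] at h0 h3
    nlinarith
  obtain ⟨θ, hθ⟩ : ∃ θ : ℝ, (Real.cos θ * z.re + Real.sin θ) * (-Real.sin θ * z.re + Real.cos θ)
        - Real.cos θ * Real.sin θ * z.im ^ 2 = 0 := by
    set F : ℝ → ℝ := fun θ => (Real.cos θ * z.re + Real.sin θ) * (-Real.sin θ * z.re + Real.cos θ)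
        - Real.cos θ * Real.sin θ * z.im ^ 2
    have hF : Continuous F := by fun_prop
    have h0 : F 0 = z.re := by simp [F]
    have h1 : F (Real.pi / 2) = - z.re := by simp [F]
    have := mem_range_of_exists_le_of_exists_ge (c := (0:ℝ)) hF
    rcases le_total z.re 0 with h | h
    · exact this ⟨0, by linarith⟩ ⟨Real.pi / 2, by linarith⟩
    · exact this ⟨Real.pi / 2, by linarith⟩ ⟨0, by linarith⟩
  exact ⟨rot θ, hfix θ, hre θ hθ⟩

/-- Every geodesic line is the image of the imaginary axis under an element of `SL(2, ℝ)`. -/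
lemma exists_eq_smul_axisPoint {s : ℝ → ℍ} (hs : Isometry s) :
    ∃ g : SL(2, ℝ), ∀ t, s t = g • axisPoint t := by
  obtain ⟨g₁, h₁⟩ := MulAction.exists_smul_eq SL(2, ℝ) (s 0) (axisPoint 0)
  obtain ⟨g₂, h₂, h₃⟩ := exists_smul_axisPoint_zero_and_re_eq_zero (g₁ • s 1)
  -- the third factor exchanges the ends of the imaginary axis if necessary
  obtain ⟨g₃, h₄, h₅⟩ : ∃ g : SL(2, ℝ), g • axisPoint 0 = axisPoint 0 ∧
      g • g₂ • g₁ • s 1 = axisPoint 1 := by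
    have hd : dist (g₂ • g₁ • s 1) (axisPoint 0) = 1 := by
      rw [← h₂, ← h₁, dist_smul, dist_smul, hs.dist_eq]; simp
    set w := g₂ • g₁ • s 1
    rw [dist_of_re_eq (by simpa using h₃)] at hd
    simp only [axisPoint_im, Real.exp_zero, Real.log_one, dist_zero_right, Real.norm_eq_abs] at hd
    have hw : (w : ℂ) = ⟨0, w.im⟩ := Complex.ext h₃ rfl
    rcases (abs_eq zero_le_one).1 hd with h | h
    · refine ⟨1, by simp, ?_⟩
      rw [one_smul]
      refine UpperHalfPlane.ext (Complex.ext h₃ ?_)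
      change w.im = Real.exp 1
      rw [← h, Real.exp_log w.im_pos]
    · have him : w.im = Real.exp (-1) := by rw [← h, Real.exp_log w.im_pos]
      let S : SL(2, ℝ) := ⟨!![0, -1; 1, 0], by simp⟩
      refine ⟨S, ?_, ?_⟩ <;> rw [specialLinear_smul_eq_iff]
      · apply Complex.ext <;> simp [S, axisPoint]
      · rw [hw, him]
        apply Complex.ext <;> simp [S, axisPoint, ← Real.exp_add]
  refine ⟨(g₃ * g₂ * g₁)⁻¹, fun t => ?_⟩
  rw [eq_inv_smul_iff]
  refine eq_axisPoint_of_isometry (s := fun t => (g₃ * g₂ * g₁) • s t)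
    ((isometry_smul ℍ (g₃ * g₂ * g₁)).comp hs) ?_ ?_ t
  · simp only [mul_smul, h₁, h₂, h₄]
  · simp only [mul_smul, h₅]

/-! ### Traces -/

lemma entries_eq_of_smul_axisPoint {g : SL(2, ℝ)} {l : ℝ}
    (h : ∀ t, g • axisPoint t = axisPoint (t + l)) :
    g 0 1 = 0 ∧ g 1 0 = 0 ∧ g 0 0 = Real.exp l * g 1 1 := by
  have h0 := (specialLinear_smul_eq_iff _ _ _).1 (h 0)
  have h1 := (specialLinear_smul_eq_iff _ _ _).1 (h 1)
  have r0 := congrArg Complex.re h0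
  have r1 := congrArg Complex.re h1
  have i0 := congrArg Complex.im h0
  simp [axisPoint, Real.exp_add] at r0 r1 i0
  have he : 1 < Real.exp 1 := by simp
  have hc : Real.exp l * g 1 0 * (Real.exp 1 ^ 2 - 1) = 0 := by linear_combination r1 - r0
  have hc' : g 1 0 = 0 := by
    rcases mul_eq_zero.1 hc with h | h
    · exact (mul_eq_zero.1 h).resolve_left (Real.exp_ne_zero l)
    · nlinarith
  refine ⟨?_, hc', i0⟩
  rw [r0, hc']; simp

lemma trace_conj (k g : SL(2, ℝ)) : ((k * g * k⁻¹ : SL(2, ℝ)) : Matrix (Fin 2) (Fin 2) ℝ).trace =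
    (g : Matrix (Fin 2) (Fin 2) ℝ).trace := by
  rw [Matrix.SpecialLinearGroup.coe_mul, Matrix.trace_mul_comm, ← Matrix.SpecialLinearGroup.coe_mul,
    inv_mul_cancel_left]

lemma trace_inv (g : SL(2, ℝ)) : ((g⁻¹ : SL(2, ℝ)) : Matrix (Fin 2) (Fin 2) ℝ).trace =
    (g : Matrix (Fin 2) (Fin 2) ℝ).trace := by
  rw [Matrix.SpecialLinearGroup.coe_inv, Matrix.trace_fin_two, Matrix.trace_fin_two,
    Matrix.adjugate_fin_two]
  simp [add_comm]

/-- The translation length of a hyperbolic isometry is determined by its trace. -/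
lemma abs_trace_of_translation {c : ℝ → ℍ} (hc : Isometry c) {g : SL(2, ℝ)} {l : ℝ}
    (h : ∀ t, c (t + l) = g • c t) :
    |(g : Matrix (Fin 2) (Fin 2) ℝ).trace| = 2 * Real.cosh (l / 2) := by
  obtain ⟨k, hk⟩ := exists_eq_smul_axisPoint hc
  obtain ⟨h01, h10, h00⟩ := entries_eq_of_smul_axisPoint (g := k⁻¹ * g * k) (l := l) (fun t => by
    rw [mul_smul, mul_smul, ← hk, ← h, hk, inv_smul_smul])
  have htr : (g : Matrix (Fin 2) (Fin 2) ℝ).trace =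
      ((k⁻¹ * g * k : SL(2, ℝ)) : Matrix (Fin 2) (Fin 2) ℝ).trace := by
    simpa using (trace_conj k⁻¹ g).symm
  have hdet := det_fin_two_eq_one (k⁻¹ * g * k)
  rw [htr, Matrix.trace_fin_two, h00]
  rw [h01, h00] at hdet
  set d := (k⁻¹ * g * k) 1 1
  rw [← abs_of_pos (show 0 < 2 * Real.cosh (l / 2) by positivity), ← sq_eq_sq_iff_abs_eq_abs]
  have e1 : Real.exp l = Real.exp (l / 2) ^ 2 := by rw [← Real.exp_nat_mul]; ring_nf
  have e2 : Real.exp (l / 2) * Real.exp (-(l / 2)) = 1 := by rw [← Real.exp_add]; simp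
  rw [Real.cosh_eq]
  rw [e1] at hdet ⊢
  have e3 : d ^ 2 = Real.exp (-(l / 2)) ^ 2 := by
    linear_combination Real.exp (-(l / 2)) ^ 2 * hdet
      - (Real.exp (l / 2) * Real.exp (-(l / 2)) + 1) * d ^ 2 * e2
  linear_combination (Real.exp (l / 2) ^ 2 + 1) ^ 2 * e3
    + ((Real.exp (l / 2) + Real.exp (-(l / 2)))
      + (Real.exp (l / 2) ^ 2 + 1) * Real.exp (-(l / 2))) * Real.exp (l / 2) * e2

/-- Elements of `SL(2, ℝ)` with the same action on `ℍ` agree up to sign. -/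
lemma eq_or_eq_neg_of_smul_eq {g h : SL(2, ℝ)} (H : ∀ z : ℍ, g • z = h • z) :
    g = h ∨ g = -h := by
  have hfix : ∀ z : ℍ, (h⁻¹ * g) • z = z := fun z => by rw [mul_smul, H, inv_smul_smul]
  obtain ⟨h01, h10, h00⟩ := entries_eq_of_smul_axisPoint (g := h⁻¹ * g) (l := 0)
    (fun t => by rw [hfix, add_zero])
  have hdet := det_fin_two_eq_one (h⁻¹ * g)
  rw [Real.exp_zero, one_mul] at h00
  rw [h01, h00] at hdet
  have h11 : (h⁻¹ * g) 1 1 = 1 ∨ (h⁻¹ * g) 1 1 = -1 := by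
    rw [← sq_eq_one_iff]; linarith
  rcases h11 with h11 | h11
  · have : h⁻¹ * g = 1 := by
      ext i j
      fin_cases i <;> fin_cases j <;> simp [h01, h10, h00, h11]
    exact Or.inl (inv_mul_eq_one.1 this).symm
  · have : h⁻¹ * g = -1 := by
      ext i j
      fin_cases i <;> fin_cases j <;> simp [h01, h10, h00, h11]
    exact Or.inr (by rw [← mul_inv_cancel_left h g, this, mul_neg, mul_one])

lemma abs_trace_eq_of_smul_eq {g h : SL(2, ℝ)} (H : ∀ z : ℍ, g • z = h • z) :
    |(g : Matrix (Fin 2) (Fin 2) ℝ).trace| = |(h : Matrix (Fin 2) (Fin 2) ℝ).trace| := by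
  rcases eq_or_eq_neg_of_smul_eq H with rfl | rfl
  · rfl
  · rw [Matrix.SpecialLinearGroup.coe_neg, Matrix.trace_neg, abs_neg]

/-! ### Reflections and boundary loops -/

/-- A reflection is the action of a matrix of negative determinant, conjugate to `z ↦ -conj z`. -/
lemma IsReflection.exists_gl {s : ℝ → ℍ} {ρ : ℍ → ℍ} (h : IsReflection s ρ) :
    ∃ N : GL (Fin 2) ℝ, N.val.det < 0 ∧ (∀ z, ρ z = N • z) ∧ ∀ z, ρ (ρ z) = z := by
  obtain ⟨hs, hρ, hfix⟩ := h
  obtain ⟨g, hg⟩ := exists_eq_smul_axisPoint hs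
  have key : ∀ z, ρ z = g • UpperHalfPlane.J • g⁻¹ • z := by
    intro z
    have hd : ∀ t, dist (g⁻¹ • ρ z) (axisPoint t) = dist (g⁻¹ • z) (axisPoint t) := by
      intro t
      have hz (w : ℍ) : dist (g⁻¹ • w) (axisPoint t) = dist w (s t) := by
        rw [hg, ← dist_smul g, smul_inv_smul]
      rw [hz, hz, ← hρ.dist_eq z, (hfix (s t)).2 ⟨t, rfl⟩]
    obtain ⟨him, hre⟩ := im_eq_and_re_sq_eq (hd 0) (hd 1)
    rw [← inv_smul_eq_iff]
    have hJ : (↑(UpperHalfPlane.J • g⁻¹ • z) : ℂ) = ⟨-(g⁻¹ • z).re, (g⁻¹ • z).im⟩ := by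
      rw [coe_J_smul]; apply Complex.ext <;> simp
    suffices h : (g⁻¹ • ρ z).re = -(g⁻¹ • z).re by
      refine UpperHalfPlane.ext ?_
      rw [hJ]
      exact Complex.ext h him
    rcases sq_eq_sq_iff_eq_or_eq_neg.1 hre with h | h
    · have h1 : g⁻¹ • ρ z = g⁻¹ • z := UpperHalfPlane.ext (Complex.ext h him)
      obtain ⟨t, ht⟩ := (hfix z).1 (smul_left_cancel _ h1)
      rw [h1, ← ht, hg, inv_smul_smul]
      simp
    · exact h
  refine ⟨(g : GL (Fin 2) ℝ) * UpperHalfPlane.J * (g : GL (Fin 2) ℝ)⁻¹, ?_,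
    fun z => ?_, fun z => ?_⟩
  · rw [← GeneralLinearGroup.val_det_apply]
    simp
  · rw [key, mul_smul, mul_smul]
    rfl
  · rw [key, key, inv_smul_smul, ← mul_smul UpperHalfPlane.J, ← sq, J_sq, one_smul, smul_inv_smul]

/-- Let `c` be a geodesic line, translated along itself by `u = ρ₁ ρ₂`, and let `x = ρ₂ ρ₀`. If the
axis of `ρ₂` meets `c` in `c τ`, then it is perpendicular to `c` there, and `ρ₂ x = ρ₀` is a
reflection again. In coordinates in which `c` is the imaginary axis this is a relation between the
off-diagonal entries of `x`: a matrix of negative determinant with a fixed point has trace `0`. -/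
lemma boundary_loop_entries {c : ℝ → ℍ} {g u x : SL(2, ℝ)} {l τ : ℝ} (hl : l ≠ 0)
    (hc : ∀ t, c t = g • axisPoint t) (hu : ∀ t, c (t + l) = u • c t)
    {s : Fin 3 → ℝ → ℍ} {ρ : Fin 3 → ℍ → ℍ} (hρ : ∀ i, IsReflection (s i) (ρ i))
    (hu' : ∀ z : ℍ, u • z = ρ 1 (ρ 2 z)) (hx : ∀ z : ℍ, x • z = ρ 2 (ρ 0 z))
    (hτ : c τ ∈ Set.range (s 2)) :
    (g⁻¹ * x * g) 0 1 = -(Real.exp τ ^ 2 * (g⁻¹ * x * g) 1 0) := by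
  obtain ⟨N, hN, hNρ, hinv⟩ := (hρ 2).exists_gl
  have hfix : ∀ i t, ρ i (s i t) = s i t := fun i t => ((hρ i).2.2 _).2 ⟨t, rfl⟩
  obtain ⟨u01, u10, u00⟩ := entries_eq_of_smul_axisPoint (g := g⁻¹ * u * g) (l := l) (fun t => by
    rw [mul_smul, mul_smul, ← hc, ← hu, hc, inv_smul_smul])
  have hudet := det_fin_two_eq_one (g⁻¹ * u * g)
  have hu_smul : ∀ z : ℍ, (g⁻¹ * u * g) • z = g⁻¹ • u • g • z := fun z => by simp only [mul_smul]
  have hx_smul : ∀ z : ℍ, (g⁻¹ * x * g) • z = g⁻¹ • x • g • z := fun z => by simp only [mul_smul]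
  -- the reflection in `s 2`, in the coordinates in which `c` is the imaginary axis
  set M : GL (Fin 2) ℝ := (g : GL (Fin 2) ℝ)⁻¹ * N * (g : GL (Fin 2) ℝ) with hM
  have hMdet : M.val.det < 0 := by
    rw [← Matrix.GeneralLinearGroup.val_det_apply] at hN ⊢
    simpa [hM] using hN
  have hMs : ∀ z : ℍ, M • z = g⁻¹ • ρ 2 (g • z) := fun z => by
    rw [hNρ, hM, mul_smul, mul_smul]
    rfl
  generalize hU : g⁻¹ * u * g = U at *
  generalize hX : g⁻¹ * x * g = X at *
  -- `A * M` has negative determinant, so that a fixed point forces trace `0`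
  have tr0 : ∀ {A : SL(2, ℝ)} {z : ℍ}, A • M • z = z →
      (A.val * M.val).trace = 0 := by
    intro A z h
    have := (exists_gl_smul_eq_self_iff_trace_eq_zero (g := (A : GL (Fin 2) ℝ) * M) (by
      rw [← Matrix.GeneralLinearGroup.val_det_apply] at hMdet ⊢
      simpa using hMdet)).1 ⟨z, by rw [mul_smul]; exact h⟩
    simpa using this
  -- applied to the reflections `ρ 2`, `u ∘ ρ 2 = ρ 1` and `x⁻¹ ∘ ρ 2 = ρ 0`
  have tM := tr0 (A := 1) (z := g⁻¹ • s 2 0) (by rw [one_smul, hMs, smul_inv_smul, hfix])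
  have tU := tr0 (A := U) (z := g⁻¹ • s 1 0) (by
    rw [hMs, hu_smul, smul_inv_smul, smul_inv_smul, hu', hinv, hfix])
  have tX := tr0 (A := X⁻¹) (z := g⁻¹ • s 0 0) (by
    rw [hMs, inv_smul_eq_iff, hx_smul, smul_inv_smul, hx, hfix])
  have hτ' : M • axisPoint τ = axisPoint τ := by
    obtain ⟨t, ht⟩ := hτ
    rw [hMs, ← hc, ← ht, hfix, ht, hc, inv_smul_smul]
  rw [gl_smul_eq_iff_num_eq, σ, if_neg (show ¬ 0 < M.det.val from not_lt_of_gt hMdet)] at hτ'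
  have hre := congrArg Complex.re hτ'
  rw [Matrix.det_fin_two] at hMdet
  rw [Matrix.SpecialLinearGroup.coe_inv, Matrix.adjugate_fin_two, Matrix.trace_fin_two,
    Matrix.mul_apply, Matrix.mul_apply, Fin.sum_univ_two, Fin.sum_univ_two] at tX
  simp [Matrix.trace_fin_two, Matrix.mul_apply, num, denom, axisPoint] at tM tU tX hre
  have hU1 : U 1 1 ≠ 0 := fun h => by rw [u01, h] at hudet; simp at hudet
  have ha : M 0 0 = 0 := by
    rw [u01, u10, u00] at tU
    have h : U 1 1 * (Real.exp l - 1) * M 0 0 = 0 := by linear_combination tU - U 1 1 * tM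
    exact (mul_eq_zero.1 h).resolve_left (mul_ne_zero hU1 (sub_ne_zero.2 (by simpa using hl)))
  have he : M 1 0 ≠ 0 := fun h => by
    rw [ha, h] at hMdet
    simp at hMdet
  have hf : M 1 1 = 0 := by linarith
  rw [ha, hf, hre] at tX
  have h : (X 0 1 + Real.exp τ ^ 2 * X 1 0) * M 1 0 = 0 := by linear_combination -tX
  linarith [(mul_eq_zero.1 h).resolve_right he]

/-! ### Lifting free homotopies -/

lemma proj_eq_iff {Γ : Subgroup SL(2, ℝ)} {z w : ℍ} :
    proj Γ z = proj Γ w ↔ ∃ g ∈ Γ, g • w = z := by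
  unfold proj
  rw [Quotient.eq]
  constructor
  · rintro ⟨g, hg⟩
    exact ⟨g, g.2, hg⟩
  · rintro ⟨g, hg, h⟩
    exact ⟨⟨g, hg⟩, h⟩

lemma proj_smul {Γ : Subgroup SL(2, ℝ)} {g : SL(2, ℝ)} (hg : g ∈ Γ) (z : ℍ) :
    proj Γ (g • z) = proj Γ z :=
  proj_eq_iff.2 ⟨g, hg, rfl⟩

/-- The projection of `ℍ` to the surface is a covering map. The group `Γ` may contain `-1`, which
acts trivially; the deck group is the image of `Γ` in the permutations of `ℍ`. -/
lemma isCoveringMap_proj {Γ : Subgroup SL(2, ℝ)} (hΓ : IsSurfaceGroup Γ) :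
    IsCoveringMap (proj Γ) := by
  have := hΓ.discrete
  let G := (MulAction.toPermHom Γ ℍ).range
  have hq : IsQuotientCoveringMap (proj Γ) G :=
    { toIsQuotientMap := isQuotientMap_quotient_mk'
      continuous_const_smul := by
        rintro ⟨_, g, rfl⟩
        exact continuous_const_smul g
      apply_eq_iff_mem_orbit := by
        intro z w
        rw [proj_eq_iff]
        constructor
        · rintro ⟨g, hg, h⟩
          exact ⟨⟨_, ⟨g, hg⟩, rfl⟩, h⟩
        · rintro ⟨⟨_, g, rfl⟩, h⟩
          exact ⟨g, g.2, h⟩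
      disjoint := by
        intro z
        obtain ⟨U, hU, h⟩ := ProperlyDiscontinuousSMul.exists_nhds_image_smul_eq_self Γ z
        refine ⟨U, hU, ?_⟩
        rintro ⟨_, g, rfl⟩ hg
        exact Subtype.ext (Equiv.ext fun w => hΓ.free g g.2 z (h g hg) w) }
  exact hq.isCoveringMap

/-- Freely homotopic closed curves on the surface have conjugate deck transformations. -/
lemma exists_conj_of_freelyHomotopic {Γ : Subgroup SL(2, ℝ)} (hΓ : IsSurfaceGroup Γ)
    {c d : ℝ → ℍ} (hc : Continuous c) (hd : Continuous d) {g k : SL(2, ℝ)} (hg : g ∈ Γ)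
    (hk : k ∈ Γ) (hcg : ∀ t, c (t + 1) = g • c t) (hdk : d 1 = k • d 0)
    (H : FreelyHomotopic (fun t => proj Γ (c t)) (fun t => proj Γ (d t))) :
    ∃ h ∈ Γ, ∀ z : ℍ, g • z = (h * k * h⁻¹) • z := by
  have cov := isCoveringMap_proj hΓ
  obtain ⟨F, hF, hper, hF0, hF1⟩ := H
  obtain ⟨Φ, ⟨h00, hΦ⟩, -⟩ := cov.existsUnique_continuousMap_lifts
    (⟨fun p : ℝ × ℝ => F p.1 p.2, hF⟩ : C(ℝ × ℝ, Surface Γ)) (a₀ := (0, 0)) (e₀ := c 0) (hF0 0).symm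
  have hΦ' : ∀ s t, proj Γ (Φ (s, t)) = F s t := fun s t => congrFun hΦ (s, t)
  -- three pairs of lifts of the same map which agree in one point
  have e0 : (fun t => Φ (0, t)) = c := cov.eq_of_comp_eq (by fun_prop) hc
    (funext fun t => by simp [hΦ', hF0]) 0 h00
  have e1 : (fun p : ℝ × ℝ => Φ (p.1, p.2 + 1)) = fun p => g • Φ p :=
    cov.eq_of_comp_eq (by fun_prop) (Φ.continuous.const_smul g)
      (funext fun p => by
        change proj Γ (Φ (p.1, p.2 + 1)) = proj Γ (g • Φ (p.1, p.2))
        rw [proj_smul hg, hΦ', hΦ', hper]) (0, 0) (by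
        change Φ (0, 0 + 1) = g • Φ (0, 0)
        rw [h00, ← hcg]
        exact congrFun e0 _)
  obtain ⟨h, hh, h1⟩ := proj_eq_iff.1 ((hΦ' 1 0).trans (hF1 0))
  have e2 : (fun t => Φ (1, t)) = fun t => h • d t := cov.eq_of_comp_eq (by fun_prop)
    (hd.const_smul h) (funext fun t => by
      change proj Γ (Φ (1, t)) = proj Γ (h • d t)
      rw [proj_smul hh, hΦ', hF1]) 0 h1.symm
  have e3 : h • k • d 0 = g • h • d 0 := by
    rw [← hdk, h1, ← congrFun e1 (1, 0)]
    simpa using (congrFun e2 1).symm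
  refine ⟨h, hh, fun z => ?_⟩
  have := hΓ.free ((h * k)⁻¹ * (g * h)) (mul_mem (inv_mem (mul_mem hh hk)) (mul_mem hg hh)) (d 0)
    (by rw [mul_smul, inv_smul_eq_iff, mul_smul, mul_smul, e3]) (h⁻¹ • z)
  rw [mul_smul, inv_smul_eq_iff, mul_smul, smul_inv_smul] at this
  rw [this, mul_smul (h * k)]

/-! ### Estimates -/

/-- The half traces `A`, `A₂`, `D`, `D₂` of the four loops below play the role of hyperbolic cosines
of half boundary lengths. The matrices of the boundary loops are `!![p, -r; r, s]` and
`!![p', -e ^ (2 τ) r'; r', s']`, and the number estimated on the left is the trace of their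
product. -/
lemma abs_trace_mul_le_of_offDiag {p r s p' r' s' h τ M : ℝ} (hh : 0 < h) (hτ : |τ| ≤ h)
    (hdet : p * s + r ^ 2 = 1) (hdet' : p' * s' + (Real.exp τ * r') ^ 2 = 1)
    (h1 : |p + s| ≤ 2 * M) (h2 : |Real.exp h * p + Real.exp (-h) * s| ≤ 2 * M)
    (h1' : |p' + s'| ≤ 2 * M) (h2' : |Real.exp (-h) * p' + Real.exp h * s'| ≤ 2 * M) :
    |p * p' + s * s' - r * r' * (Real.exp τ ^ 2 + 1)| * (Real.cosh h - 1) ≤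
      2 * (Real.cosh h * (Real.cosh h - 1) + 2 * M ^ 2 * (Real.cosh h + 1)) := by
  obtain ⟨A, hA⟩ : ∃ A, p + s = 2 * A := ⟨(p + s) / 2, by ring⟩
  obtain ⟨A₂, hA₂⟩ : ∃ A, Real.exp h * p + Real.exp (-h) * s = 2 * A :=
    ⟨(Real.exp h * p + Real.exp (-h) * s) / 2, by ring⟩
  obtain ⟨D, hD⟩ : ∃ A, p' + s' = 2 * A := ⟨(p' + s') / 2, by ring⟩
  obtain ⟨D₂, hD₂⟩ : ∃ A, Real.exp (-h) * p' + Real.exp h * s' = 2 * A :=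
    ⟨(Real.exp (-h) * p' + Real.exp h * s') / 2, by ring⟩
  have hC : 1 < Real.cosh h := Real.one_lt_cosh.2 hh.ne'
  have hS : 0 < Real.sinh h := Real.sinh_pos_iff.2 hh
  have hCS : Real.cosh h ^ 2 = Real.sinh h ^ 2 + 1 := Real.cosh_sq h
  have hexp : Real.exp h = Real.cosh h + Real.sinh h := (Real.cosh_add_sinh h).symm
  have hexpn : Real.exp (-h) = Real.cosh h - Real.sinh h := (Real.cosh_sub_sinh h).symm
  rw [hexp, hexpn] at hA₂ hD₂
  rw [hA, abs_le] at h1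
  rw [hexp, hexpn, hA₂, abs_le] at h2
  rw [hD, abs_le] at h1'
  rw [hexp, hexpn, hD₂, abs_le] at h2'
  have hw : Real.exp τ + Real.exp (-τ) ≤ 2 * Real.cosh h := by
    have := Real.cosh_le_cosh.2 (hτ.trans (le_abs_self h))
    rw [Real.cosh_eq τ] at this
    linarith
  have hττ : Real.exp τ * Real.exp (-τ) = 1 := by rw [← Real.exp_add]; simp
  have hw0 : 0 < Real.exp τ + Real.exp (-τ) := by positivity
  -- the entries of the second matrix after moving the foot of its seam to `i`
  set w := Real.exp τ * r' with hwdef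
  have hrw : r * r' * (Real.exp τ ^ 2 + 1) = r * w * (Real.exp τ + Real.exp (-τ)) := by
    rw [hwdef]; linear_combination (-r * r') * hττ
  rw [hrw]
  set W := Real.exp τ + Real.exp (-τ)
  set C := Real.cosh h
  set S := Real.sinh h
  have hp : S * p = A₂ - A * (C - S) := by linear_combination hA₂ / 2 - (C - S) / 2 * hA
  have hs : S * s = A * (C + S) - A₂ := by linear_combination (C + S) / 2 * hA - hA₂ / 2
  have hp' : S * p' = D * (C + S) - D₂ := by linear_combination (C + S) / 2 * hD - hD₂ / 2
  have hs' : S * s' = D₂ - D * (C - S) := by linear_combination hD₂ / 2 - (C - S) / 2 * hD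
  have bound : ∀ {a b : ℝ}, (-(2 * M) ≤ 2 * a ∧ 2 * a ≤ 2 * M) →
      (-(2 * M) ≤ 2 * b ∧ 2 * b ≤ 2 * M) → |a * b| ≤ M ^ 2 := by
    intro a b ha hb
    rw [abs_mul, sq]
    exact mul_le_mul (abs_le.2 ⟨by linarith, by linarith⟩) (abs_le.2 ⟨by linarith, by linarith⟩)
      (abs_nonneg _) (by linarith)
  have key : S ^ 2 * (p * p' + s * s') = 2 * C * (A₂ * D + A * D₂) - 2 * A₂ * D₂ - 2 * A * D := by
    linear_combination (S * p') * hp + (A₂ - A * (C - S)) * hp' + (S * s') * hs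
      + (A * (C + S) - A₂) * hs' - 2 * A * D * hCS
  have hN : ∀ {a b x : ℝ}, (-(2 * M) ≤ 2 * a ∧ 2 * a ≤ 2 * M) → (-(2 * M) ≤ 2 * b ∧ 2 * b ≤ 2 * M) →
      S ^ 2 * x ^ 2 = C ^ 2 - 1 + b ^ 2 + a ^ 2 - 2 * a * b * C →
      S ^ 2 * x ^ 2 ≤ C ^ 2 - 1 + 2 * M ^ 2 * (1 + C) := by
    intro a b x ha hb hx
    have h1 := (abs_le.1 (bound ha ha)).2
    have h2 := (abs_le.1 (bound hb hb)).2
    have h3 := (abs_le.1 (bound ha hb)).1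
    nlinarith
  -- the determinants determine `r` and `w` up to sign
  have hr : S ^ 2 * r ^ 2 ≤ C ^ 2 - 1 + 2 * M ^ 2 * (1 + C) := hN h1 h2 (by
    linear_combination S ^ 2 * hdet - S * s * hp - (A₂ - A * (C - S)) * hs + (A ^ 2 - 1) * hCS)
  have hw' : S ^ 2 * w ^ 2 ≤ C ^ 2 - 1 + 2 * M ^ 2 * (1 + C) := hN h1' h2' (by
    linear_combination S ^ 2 * hdet' - S * s' * hp' - (D * (C + S) - D₂) * hs' + (D ^ 2 - 1) * hCS)
  have hrw' : S ^ 2 * |r * w| ≤ C ^ 2 - 1 + 2 * M ^ 2 * (1 + C) := by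
    have : |r * w| ≤ (r ^ 2 + w ^ 2) / 2 := by
      have := two_mul_le_add_sq |r| |w|
      rw [sq_abs, sq_abs] at this
      rw [abs_mul]
      linarith
    have := mul_le_mul_of_nonneg_left this (sq_nonneg S)
    linarith
  have h3 : S ^ 2 * |p * p' + s * s'| ≤ 4 * M ^ 2 * (C + 1) := by
    rw [← abs_of_pos (show 0 < S ^ 2 by positivity), ← abs_mul, key, abs_le]
    have b1 := abs_le.1 (bound h2 h1')
    have b2 := abs_le.1 (bound h1 h2')
    have b3 := abs_le.1 (bound h2 h2')
    have b4 := abs_le.1 (bound h1 h1')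
    have hC0 : 0 ≤ C := by linarith
    have c1 := mul_le_mul_of_nonneg_left b1.1 hC0
    have c2 := mul_le_mul_of_nonneg_left b1.2 hC0
    have c3 := mul_le_mul_of_nonneg_left b2.1 hC0
    have c4 := mul_le_mul_of_nonneg_left b2.2 hC0
    constructor <;> linarith
  have h4 : |p * p' + s * s' - r * w * W| ≤ |p * p' + s * s'| + |r * w| * (2 * C) := by
    refine (abs_sub _ _).trans ?_
    rw [abs_mul (r * w), abs_of_pos hw0]
    gcongr
  have h5 : S ^ 2 * |p * p' + s * s' - r * w * W| ≤
      4 * M ^ 2 * (C + 1) + (C ^ 2 - 1 + 2 * M ^ 2 * (1 + C)) * (2 * C) := by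
    calc _ ≤ S ^ 2 * (|p * p' + s * s'| + |r * w| * (2 * C)) := by gcongr
      _ = S ^ 2 * |p * p' + s * s'| + S ^ 2 * |r * w| * (2 * C) := by ring
      _ ≤ _ := by gcongr
  have h6 : S ^ 2 = (C - 1) * (C + 1) := by linear_combination -hCS
  rw [h6] at h5
  refine le_of_mul_le_mul_right (a := C + 1) ?_ (by linarith)
  linarith

/-- The passage from the trace estimate to the bound for the length. The hypothesis `I ≤ l` absorbs
`coth² (l / 4)`, and `l ≤ B` the remaining growth in `l`. -/
lemma le_of_two_cosh_mul_le {L l B I : ℝ} (hI : 0 < I) (hIl : I ≤ l) (hlB : l ≤ B)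
    (h : 2 * Real.cosh (L / 2) * (Real.cosh (l / 2) - 1) ≤
      2 * (Real.cosh (l / 2) * (Real.cosh (l / 2) - 1)
        + 2 * Real.cosh (B / 2) ^ 2 * (Real.cosh (l / 2) + 1))) :
    L ≤ 3 * B - 4 * Real.log I + 12 * Real.log 2 := by
  have hl : 0 < l := hI.trans_le hIl
  have hB : 0 < B := hl.trans_le hlB
  set C := Real.cosh (l / 2) with hCdef
  set M := Real.cosh (B / 2) with hMdef
  set x := l / 4 with hx
  have hx0 : 0 < x := by positivity
  have hC : C = 2 * Real.sinh x ^ 2 + 1 := by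
    rw [hCdef, show l / 2 = 2 * x by rw [hx]; ring, Real.cosh_two_mul, Real.cosh_sq]; ring
  have hsx : 0 < Real.sinh x := Real.sinh_pos_iff.2 hx0
  have hCM : C ≤ M := Real.cosh_le_cosh.2 (by
    rw [abs_of_pos (by positivity), abs_of_pos (by positivity)]; linarith)
  have hME : M ≤ Real.exp (B / 2) := by
    rw [hMdef, Real.cosh_eq]
    have : Real.exp (-(B / 2)) ≤ Real.exp (B / 2) := Real.exp_le_exp.2 (by linarith)
    linarith
  have hM1 : 1 ≤ M := Real.one_le_cosh _
  -- `coth x ≤ 1 + 1 / x`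
  have hcoth : x ^ 2 * Real.cosh x ^ 2 ≤ (1 + x) ^ 2 * Real.sinh x ^ 2 := by
    rw [← mul_pow, ← mul_pow]
    have h1 : x ≤ Real.sinh x := Real.self_le_sinh_iff.2 hx0.le
    have h2 := Real.cosh_sub_sinh x
    have h3 : Real.exp (-x) ≤ 1 := Real.exp_le_one_iff.2 (by linarith)
    have : x * Real.cosh x ≤ (1 + x) * Real.sinh x := by nlinarith
    gcongr
  have h1 : 2 * Real.cosh (L / 2) * x ^ 2 ≤ 2 * M * x ^ 2 + 4 * M ^ 2 * (1 + x) ^ 2 := by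
    have hC1 : C + 1 = 2 * Real.cosh x ^ 2 := by rw [hC, Real.cosh_sq]; ring
    have hC2 : C - 1 = 2 * Real.sinh x ^ 2 := by rw [hC]; ring
    rw [hC1, hC2] at h
    have : 2 * Real.cosh (L / 2) * x ^ 2 * Real.sinh x ^ 2 ≤
        (2 * C * x ^ 2 + 4 * M ^ 2 * (1 + x) ^ 2) * Real.sinh x ^ 2 := by
      have := mul_le_mul_of_nonneg_left hcoth (show 0 ≤ 4 * M ^ 2 by positivity)
      have := mul_le_mul_of_nonneg_right h (sq_nonneg x)
      linarith
    have := le_of_mul_le_mul_right this (by positivity)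
    nlinarith [sq_nonneg x]
  have h2 : Real.exp (L / 2) ≤ 2 * Real.cosh (L / 2) := by
    rw [Real.cosh_eq]; have := Real.exp_pos (-(L / 2)); linarith
  set E := Real.exp (B / 2) with hE
  have hE1 : 1 ≤ E := hM1.trans hME
  -- `exp (l / 2) ≥ 1 + 2 x + 2 x ^ 2`
  have h3 : 1 + 2 * x + 2 * x ^ 2 ≤ E := by
    have := Real.quadratic_le_exp_of_nonneg (show 0 ≤ l / 2 by positivity)
    have h4 : Real.exp (l / 2) ≤ E := Real.exp_le_exp.2 (by linarith)
    rw [show l / 2 = 2 * x by rw [hx]; ring] at this h4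
    nlinarith
  have h4 : Real.exp (L / 2) * x ^ 2 ≤ 4 * E ^ 3 := by
    have hM0 : 0 ≤ M := by linarith
    calc _ ≤ 2 * Real.cosh (L / 2) * x ^ 2 := by gcongr
      _ ≤ 2 * E * x ^ 2 + 4 * E ^ 2 * (1 + x) ^ 2 := h1.trans (by gcongr)
      _ ≤ 4 * E ^ 2 * x ^ 2 + 4 * E ^ 2 * (1 + x) ^ 2 := by
        have : E ≤ E ^ 2 := by nlinarith
        nlinarith [sq_nonneg x]
      _ = 4 * E ^ 2 * (1 + 2 * x + 2 * x ^ 2) := by ring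
      _ ≤ 4 * E ^ 2 * E := by gcongr
      _ = 4 * E ^ 3 := by ring
  have h5 : Real.exp (L / 2) * I ^ 2 ≤ 2 ^ 6 * E ^ 3 := by
    have : I ^ 2 ≤ l ^ 2 := by gcongr
    have : Real.exp (L / 2) * I ^ 2 ≤ Real.exp (L / 2) * l ^ 2 := by gcongr
    rw [hx] at h4
    linarith
  have h6 := Real.log_le_log (by positivity) h5
  rw [Real.log_mul (by positivity) (by positivity), Real.log_mul (by positivity) (by positivity),
    Real.log_pow, Real.log_pow, Real.log_pow, Real.log_exp, hE, Real.log_exp] at h6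
  push_cast at h6
  linarith

/-! ### Transversals -/

variable {Γ : Subgroup SL(2, ℝ)} {m : ℕ} {P : PantsDecomposition Γ m}

/-- Boundary loops of pairs of pants have bounded trace; those around a cusp have trace `± 2`. -/
lemma abs_trace_le_of_loop {B : ℝ} (hB : ∀ j, (P.γ j).length ≤ B) {x : SL(2, ℝ)}
    (hx : P.IsPantsCurveLoop x ∨ IsCuspLoop Γ x) :
    |(x : Matrix (Fin 2) (Fin 2) ℝ).trace| ≤ 2 * Real.cosh (B / 2) := by
  rcases hx with ⟨i, h, -, hx⟩ | ⟨-, ⟨-, hx⟩, -⟩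
  · have htr : |(x : Matrix (Fin 2) (Fin 2) ℝ).trace| = 2 * Real.cosh ((P.γ i).length / 2) := by
      rw [← abs_trace_of_translation (P.γ i).isometry_lift (P.γ i).lift_add]
      rcases hx with hx | hx <;> rw [abs_trace_eq_of_smul_eq hx, trace_conj]
      rw [trace_inv]
    have := (P.γ i).length_pos
    have := hB i
    rw [htr, mul_le_mul_iff_right₀ two_pos, Real.cosh_le_cosh, abs_of_pos (by linarith),
      abs_of_pos (by linarith)]
    linarith
  · rw [Matrix.discr_fin_two, x.2] at hx
    have : |(x : Matrix (Fin 2) (Fin 2) ℝ).trace| = 2 := by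
      rw [← abs_two (α := ℝ), ← sq_eq_sq_iff_abs_eq_abs]
      linarith
    rw [this]
    linarith [Real.one_le_cosh (B / 2)]

namespace HexagonDecomposition

variable {R : Set ℍ} (F : HexagonDecomposition P R)

/-- The three boundary loops of a pair of pants have product `1`. -/
lemma loop_zero_smul_loop_one_smul (z : ℍ) :
    F.loop 0 • F.loop 1 • z = (F.loop 2)⁻¹ • z := by
  have hinv : ∀ i z, F.refl i (F.refl i z) = z := fun i => by
    obtain ⟨-, -, -, h⟩ := (F.isReflection i).exists_gl
    exact h
  obtain ⟨w, rfl⟩ : ∃ w, F.loop 2 • w = z := ⟨_, smul_inv_smul _ z⟩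
  rw [inv_smul_smul, F.loop_smul 0, F.loop_smul 1, F.loop_smul 2]
  change F.refl 1 (F.refl 2 (F.refl 2 (F.refl 0 (F.refl 0 (F.refl 1 w))))) = w
  rw [hinv, hinv, hinv]

lemma abs_trace_mul_le {B : ℝ} (hB : ∀ j, (P.γ j).length ≤ B) {u : SL(2, ℝ)}
    (hu : ∀ z : ℍ, F.loop 0 • z = u • z) :
    |((u * F.loop 1 : SL(2, ℝ)) : Matrix (Fin 2) (Fin 2) ℝ).trace| ≤ 2 * Real.cosh (B / 2) := by
  rw [abs_trace_eq_of_smul_eq (h := (F.loop 2)⁻¹) fun z => by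
    rw [mul_smul, ← hu, F.loop_zero_smul_loop_one_smul], trace_inv]
  exact abs_trace_le_of_loop hB (F.loop_end 2)

end HexagonDecomposition

lemma ClosedGeodesic.systole_le_length (c : ClosedGeodesic Γ) : systole Γ ≤ c.length :=
  csInf_le ⟨0, by rintro _ ⟨d, rfl⟩; exact d.length_pos.le⟩ ⟨c, rfl⟩

lemma trace_mul_fin_two (a b : SL(2, ℝ)) :
    ((a * b : SL(2, ℝ)) : Matrix (Fin 2) (Fin 2) ℝ).trace =
      a 0 0 * b 0 0 + a 0 1 * b 1 0 + (a 1 0 * b 0 1 + a 1 1 * b 1 1) := by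
  rw [Matrix.SpecialLinearGroup.coe_mul, Matrix.trace_fin_two, Matrix.mul_apply, Matrix.mul_apply,
    Fin.sum_univ_two, Fin.sum_univ_two]

/-- The bound `cosh (l(δ) / 2) ≤ C + 2 M ^ 2 (C + 1) / (C - 1)` for a transversal `δ` to a pants
curve of length `l`, where `C = cosh (l / 2)` and `M = cosh (B / 2)`, with the denominator
cleared. -/
lemma IsTransversal.cosh_half_length_le (hΓ : IsSurfaceGroup Γ) {j : Fin m} {δ : ClosedGeodesic Γ}
    (hδ : IsTransversal P j δ) {B : ℝ} (hB : ∀ j, (P.γ j).length ≤ B) :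
    2 * Real.cosh (δ.length / 2) * (Real.cosh ((P.γ j).length / 2) - 1) ≤
      2 * (Real.cosh ((P.γ j).length / 2) * (Real.cosh ((P.γ j).length / 2) - 1)
        + 2 * Real.cosh (B / 2) ^ 2 * (Real.cosh ((P.γ j).length / 2) + 1)) := by
  obtain ⟨R, R', F, F', s, α, f, f', o, o', σ, -, -, -, hF, hF', hα, rfl, hf, rfl, hf', -, -, -, -,
    hσ, hhom⟩ := hδ
  set l := (P.γ j).length with hl
  have hl0 : 0 < l := (P.γ j).length_pos
  set u := (P.γ j).hol
  set x := F.loop 1 with hx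
  set y := F'.loop 1 with hy
  -- the trace of the deck transformation of `δ`
  obtain ⟨k, -, hk⟩ := exists_conj_of_freelyHomotopic hΓ (c := fun t => δ.lift (t * δ.length))
    (δ.isometry_lift.continuous.comp (by fun_prop)) hσ.continuous δ.hol_mem
    (mul_mem (F'.loop_mem 1) (F.loop_mem 1))
    (fun t => by rw [add_mul, one_mul, δ.lift_add]) (by simpa using hσ.periodic 0) hhom
  rw [← abs_trace_of_translation δ.isometry_lift δ.lift_add, abs_trace_eq_of_smul_eq hk, trace_conj]
  -- coordinates in which the lift of the pants curve is the imaginary axis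
  obtain ⟨g, hg⟩ := exists_eq_smul_axisPoint (s := fun t => (P.γ j).lift (s + t))
    ((P.γ j).isometry_lift.comp (IsometryEquiv.addLeft s).isometry)
  have hu : ∀ t, (P.γ j).lift (s + (t + l)) = u • (P.γ j).lift (s + t) := fun t => by
    rw [← add_assoc, (P.γ j).lift_add]
  have hu' : ∀ t, (P.γ j).lift (s + (t + -l)) = u⁻¹ • (P.γ j).lift (s + t) := fun t => by
    rw [eq_inv_smul_iff, ← hu, neg_add_cancel_right]
  have hX := boundary_loop_entries (τ := 0) hl0.ne' hg hu F.isReflection (x := x)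
    (fun z => by rw [← hF, F.loop_smul]; rfl) (fun z => by rw [hx, F.loop_smul]; rfl)
    (by simpa using hf)
  have hY := boundary_loop_entries (neg_ne_zero.2 hl0.ne') hg hu' F'.isReflection (x := y)
    (fun z => by rw [← hF', F'.loop_smul]; rfl) (fun z => by rw [hy, F'.loop_smul]; rfl) hf'
  obtain ⟨u01, u10, u00⟩ := entries_eq_of_smul_axisPoint (g := g⁻¹ * u * g) (l := l) (fun t => by
    rw [mul_smul, mul_smul, ← hg, ← hu, hg, inv_smul_smul])
  have conj_tr : ∀ a : SL(2, ℝ), (a : Matrix (Fin 2) (Fin 2) ℝ).trace =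
      ((g⁻¹ * a * g : SL(2, ℝ)) : Matrix (Fin 2) (Fin 2) ℝ).trace := fun a => by
    simpa using (trace_conj g⁻¹ a).symm
  have conj_mul : ∀ a b : SL(2, ℝ), g⁻¹ * (a * b) * g = g⁻¹ * a * g * (g⁻¹ * b * g) := fun a b => by
    group
  have conj_inv : g⁻¹ * u⁻¹ * g = (g⁻¹ * u * g)⁻¹ := by group
  have t1 := abs_trace_le_of_loop hB (F.loop_end 1)
  have t2 := F.abs_trace_mul_le hB hF
  have t1' := abs_trace_le_of_loop hB (F'.loop_end 1)
  have t2' := F'.abs_trace_mul_le hB hF'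
  rw [conj_tr, Matrix.trace_fin_two] at t1 t1'
  rw [conj_tr, conj_mul, trace_mul_fin_two] at t2 t2'
  rw [conj_tr, conj_mul, trace_mul_fin_two]
  rw [conj_inv] at t2'
  rw [← hx] at t1 t2
  rw [← hy] at t1' t2'
  have hudet := det_fin_two_eq_one (g⁻¹ * u * g)
  have hXdet := det_fin_two_eq_one (g⁻¹ * x * g)
  have hYdet := det_fin_two_eq_one (g⁻¹ * y * g)
  generalize g⁻¹ * u * g = U at *
  generalize g⁻¹ * x * g = X at *
  generalize g⁻¹ * y * g = Y at *
  have hinv : U⁻¹ 0 0 = U 1 1 ∧ U⁻¹ 0 1 = 0 ∧ U⁻¹ 1 0 = 0 ∧ U⁻¹ 1 1 = U 0 0 := by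
    rw [Matrix.SpecialLinearGroup.coe_inv, Matrix.adjugate_fin_two]
    simp [u01, u10]
  obtain ⟨v00, v01, v10, v11⟩ := hinv
  rw [v00, v01, v10, v11] at t2'
  rw [u01, u10] at t2
  rw [u01, u00] at hudet
  -- the action of `U` on `ℍ` determines its entries up to a common sign
  have hsign : (U 0 0 = Real.exp (l / 2) ∧ U 1 1 = Real.exp (-(l / 2))) ∨
      (U 0 0 = -Real.exp (l / 2) ∧ U 1 1 = -Real.exp (-(l / 2))) := by
    have e1 : Real.exp l = Real.exp (l / 2) * Real.exp (l / 2) := by rw [← Real.exp_add]; ring_nf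
    have e2 : Real.exp (l / 2) * Real.exp (-(l / 2)) = 1 := by rw [← Real.exp_add]; simp
    have e3 : (Real.exp (l / 2) * U 1 1) ^ 2 = 1 := by rw [e1] at hudet; linarith
    rw [u00, e1]
    have h0 := Real.exp_ne_zero (l / 2)
    rcases sq_eq_one_iff.1 e3 with h | h
    · refine Or.inl ⟨by rw [mul_assoc, h, mul_one], mul_left_cancel₀ h0 (by rw [h, e2])⟩
    · refine Or.inr ⟨by rw [mul_assoc, h]; ring, mul_left_cancel₀ h0 (by rw [h, mul_neg, e2])⟩
  have t3 : |Real.exp (l / 2) * X 0 0 + Real.exp (-(l / 2)) * X 1 1| ≤ 2 * Real.cosh (B / 2) := by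
    rcases hsign with ⟨h, h'⟩ | ⟨h, h'⟩ <;> rw [h, h'] at t2
    · simpa using t2
    · rw [← abs_neg]
      convert t2 using 2
      ring
  have t3' : |Real.exp (-(l / 2)) * Y 0 0 + Real.exp (l / 2) * Y 1 1| ≤ 2 * Real.cosh (B / 2) := by
    rcases hsign with ⟨h, h'⟩ | ⟨h, h'⟩ <;> rw [h, h'] at t2'
    · simpa using t2'
    · rw [← abs_neg]
      convert t2' using 2
      ring
  rw [Real.exp_zero] at hX
  have hτ : |α * l| ≤ l / 2 := by
    rw [abs_le]
    constructor <;> nlinarith [hα.1, hα.2]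
  have main := abs_trace_mul_le_of_offDiag (p := X 0 0) (s := X 1 1) (r := X 1 0) (p' := Y 0 0)
    (s' := Y 1 1) (r' := Y 1 0) (half_pos hl0) hτ (by rw [hX] at hXdet; linarith)
    (by rw [hY] at hYdet; linarith) t1 t3 t1' t3'
  convert main using 3
  rw [hX, hY]
  ring

end HypSurf

theorem proposition5p3 (Γ : Subgroup SL(2, ℝ)) (hΓ : HypSurf.IsSurfaceGroup Γ)
    (B I : ℝ) (hI : 0 < I) (hsys : I ≤ HypSurf.systole Γ)
    (m : ℕ) (P : HypSurf.PantsDecomposition Γ m) (hB : ∀ j, (P.γ j).length ≤ B)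
    (j : Fin m) (δ : HypSurf.ClosedGeodesic Γ) (hδ : HypSurf.IsTransversal P j δ) :
    δ.length ≤ 3 * B - 4 * Real.log I + 12 * Real.log 2 :=
  HypSurf.le_of_two_cosh_mul_le hI (hsys.trans (P.γ j).systole_le_length) (hB j)
    (hδ.cosh_half_length_le hΓ hB)
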